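/- For a Borel probability measure $\mu$ on $\mathbb C$ whose support $K=\operatorname{supp}(\mu)$ is a compact set of positive logarithmic capacity $C(K)$, let $\mu_K$ be the equilibrium measure of $K$, let $d\mu=f\,d\mu_K+d\mu_s$ be the Lebesgue decomposition of $\mu$ with respect to $\mu_K$, and put $$S(\mu)=\exp\Big[\int\log f\,d\mu_K\Big]$$ (with $S(\mu)=0$ if the integral is $-\infty$). For $0<p<\infty$ and $n\in\mathbb N$ let $$W_n^p(\mu)=\frac{\inf_{P}\big(\int|P|^p\,d\mu\big)^{1/p}}{C(K)^n},$$ where the infimum is over all monic polynomials $P$ of degree $n$ with complex coefficients. **Theorem 2.2.** For each fixed $0<p<\infty$ and $n\in\mathbb N$, $$\inf_{\mu}\frac{\big[W_n^p(\mu)\big]^p}{S(\mu)}=1,$$ where the infimum is taken over all Borel probability measures $\mu$ with $\operatorname{supp}(\mu)=[-2,2]$ and $S(\mu)>0$. -/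

import Mathlib

open MeasureTheory Polynomial
open scoped ENNReal

namespace WidomFactors

noncomputable section

/-- The integral of an extended-real-valued function, as the integral of its positive part minus
the integral of its negative part. It is the usual quasi-integral with values in `[-∞, ∞]` as soon
as the positive part has finite integral, which is the case at all its uses below for measures
of compact support. -/
def extIntegral {α : Type*} [MeasurableSpace α] (ν : Measure α) (g : α → EReal) : EReal :=
  ((∫⁻ x, (g x).toENNReal ∂ν : ℝ≥0∞) : EReal) - ((∫⁻ x, (-g x).toENNReal ∂ν : ℝ≥0∞) : EReal)

/-- The logarithmic energy `I(ν) = ∬ log |z - w| dν(z) dν(w)`, where `log 0 = -∞`. -/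
def logEnergy (ν : Measure ℂ) : EReal :=
  extIntegral (ν.prod ν) fun q => ENNReal.log (edist q.1 q.2)

/-- The Borel probability measures on `ℂ` carried by the set `K`. -/
def probOn (K : Set ℂ) : Set (Measure ℂ) :=
  {ν | IsProbabilityMeasure ν ∧ ν Kᶜ = 0}

/-- The logarithmic capacity `C(K) = exp (sup {I(ν) : ν a probability measure on K})` of a compact
set `K` (it is `0` exactly when `K` is polar). -/
def capacity (K : Set ℂ) : ℝ≥0∞ :=
  EReal.exp (⨆ ν ∈ probOn K, logEnergy ν)

/-- `ν` is an equilibrium measure of `K`: it has the largest value of `I` (with this sign of the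
kernel, the least electrostatic energy) among the probability measures on `K`. -/
def IsEquilibriumMeasure (K : Set ℂ) (ν : Measure ℂ) : Prop :=
  IsMaxOn logEnergy (probOn K) ν ∧ ν ∈ probOn K

open Classical in
/-- The equilibrium measure `μ_K` of a compact non-polar set `K`, for which exactly one measure
satisfies `IsEquilibriumMeasure K` (with the value `0` for sets that have no equilibrium measure,
for instance the empty set). -/
def equilibriumMeasure (K : Set ℂ) : Measure ℂ :=
  if h : ∃ ν, IsEquilibriumMeasure K ν then h.choose else 0

/-- The exponential relative entropy `S(μ) = exp (∫ log f dμ_K)`, where `K = supp μ` and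
`dμ = f dμ_K + dμ_s` is the Lebesgue decomposition of `μ` with respect to `μ_K`. It is `0` when
the integral is `-∞`. -/
def entropyS (μ : Measure ℂ) : ℝ≥0∞ :=
  EReal.exp (extIntegral (equilibriumMeasure μ.support) fun z =>
    ENNReal.log (μ.rnDeriv (equilibriumMeasure μ.support) z))

/-- The Widom factor `W_n^p(μ) = inf ‖P‖_{L^p(μ)} / C(K)^n`, where `K = supp μ` and the infimum is
over the monic polynomials `P` of degree `n` with complex coefficients. -/
def widomFactor (p : ℝ≥0∞) (n : ℕ) (μ : Measure ℂ) : ℝ≥0∞ :=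
  (⨅ P : {P : ℂ[X] // P.Monic ∧ P.natDegree = n}, eLpNorm (fun z => P.1.eval z) p μ) /
    capacity μ.support ^ n

/-- The real interval `[-2, 2]` as a subset of `ℂ`. -/
def interval : Set ℂ :=
  (fun x : ℝ => (x : ℂ)) '' Set.Icc (-2) 2

end

end WidomFactors

/-! Everything rests on the arcsine law of [-2, 2]. At z = w + 1/w its potential is log⁺|w| +
log⁺|1/w|: nonnegative everywhere and zero on the interval, so its energy is 0. For a general ν on
the interval, the expansion log|2 cos θ - 2 cos φ| = -∑ (2/k) cos kθ cos kφ suggests the energy -∑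
(2/k) m_k², with m_k the Chebyshev moments; `logEnergy_le` proves the bound by any single term.
Hence the capacity is 1, and a maximizer has m_k = 0 for all k ≥ 1, which forces it to be the
arcsine law.

Lower bound (`entropyS_le_lintegral`): drop the singular part and apply Jensen, ∫|P|^p dμ ≥ exp ∫
(log f + p log|P|) dμ_K ≥ S(μ), because ∫ log|P| dμ_K ≥ 0 for monic P.

Sharpness (`exists_widomFactor_rpow_div_le`): for f proportional to |y - z|^(-np) with z = t + 1/t
outside the interval, and P = (X - z)^n, the product f|P|^p is constant, so Jensen is an equality.
Only the factor exp(np ∫ log|y - z| dμ_K) = t^(np) is lost, and it tends to 1 as t ↓ 1. -/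

namespace WidomFactors

/-! ### Extended integrals. -/

section ExtIntegral

variable {α : Type*} [MeasurableSpace α] {ν : Measure α} {g h : α → EReal}

theorem extIntegral_congr_ae (H : g =ᵐ[ν] h) : extIntegral ν g = extIntegral ν h := by
  have h1 : ∫⁻ x, (g x).toENNReal ∂ν = ∫⁻ x, (h x).toENNReal ∂ν :=
    lintegral_congr_ae (H.mono fun x hx => by simp only [hx])
  have h2 : ∫⁻ x, (-g x).toENNReal ∂ν = ∫⁻ x, (-h x).toENNReal ∂ν :=
    lintegral_congr_ae (H.mono fun x hx => by simp only [hx])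
  rw [extIntegral, extIntegral, h1, h2]

theorem extIntegral_coe {φ : α → ℝ} (hφ : Integrable φ ν) :
    extIntegral ν (fun x => (φ x : EReal)) = ((∫ x, φ x ∂ν : ℝ) : EReal) := by
  have h1 : ∫⁻ x, ENNReal.ofReal (φ x) ∂ν ≠ ⊤ := hφ.lintegral_lt_top.ne
  have h2 : ∫⁻ x, ENNReal.ofReal (-φ x) ∂ν ≠ ⊤ := hφ.neg.lintegral_lt_top.ne
  rw [integral_eq_lintegral_pos_part_sub_lintegral_neg_part hφ, EReal.coe_sub,
    EReal.coe_ennreal_toReal h1, EReal.coe_ennreal_toReal h2, extIntegral]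
  rfl

/-- A function whose extended integral is not `-∞`, with a finite integral of the positive part,
is a.e. real-valued and integrable. -/
theorem exists_integrable_of_bot_lt_extIntegral (hg : Measurable g)
    (hpos : ∫⁻ x, (g x).toENNReal ∂ν ≠ ⊤) (hbot : ⊥ < extIntegral ν g) :
    Integrable (fun x => (g x).toReal) ν ∧ g =ᵐ[ν] fun x => ((g x).toReal : EReal) := by
  have hneg : ∫⁻ x, (-g x).toENNReal ∂ν ≠ ⊤ := by
    intro H
    rw [extIntegral, H] at hbot
    simp at hbot
  have m1 : Measurable fun x => (g x).toENNReal := hg.ereal_toENNReal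
  have m2 : Measurable fun x => (-g x).toENNReal := hg.neg.ereal_toENNReal
  have f1 := ae_lt_top m1 hpos
  have f2 := ae_lt_top m2 hneg
  have hae : g =ᵐ[ν] fun x => ((g x).toReal : EReal) := by
    filter_upwards [f1, f2] with x h1 h2
    refine (EReal.coe_toReal ?_ ?_).symm
    · exact EReal.toENNReal_ne_top_iff.1 h1.ne
    · intro H; simp [H] at h2
  refine ⟨⟨(measurable_ereal_toReal.comp hg).aestronglyMeasurable, ?_⟩, hae⟩
  have key : ∀ᵐ x ∂ν, ‖(g x).toReal‖ₑ ≤ (g x).toENNReal + (-g x).toENNReal := by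
    filter_upwards [hae] with x hx
    rw [hx]
    generalize (g x).toReal = r
    rw [EReal.toReal_coe, ← EReal.coe_neg, EReal.real_coe_toENNReal, EReal.real_coe_toENNReal,
      Real.enorm_eq_ofReal_abs]
    rcases le_total 0 r with hr | hr
    · rw [abs_of_nonneg hr]; exact le_self_add
    · rw [abs_of_nonpos hr]; exact le_add_self
  refine (lintegral_mono_ae key).trans_lt ?_
  rw [lintegral_add_left m1]
  exact ENNReal.add_lt_top.2 ⟨hpos.lt_top, hneg.lt_top⟩

end ExtIntegral

/-! ### The interval and its arcsine law. -/

theorem isCompact_interval : IsCompact interval :=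
  isCompact_Icc.image Complex.continuous_ofReal

theorem mem_interval_iff_exists_angle {z : ℂ} :
    z ∈ interval ↔ ∃ θ ∈ Set.Icc 0 Real.pi, z = ((2 * Real.cos θ : ℝ) : ℂ) := by
  constructor
  · rintro ⟨x, hx, rfl⟩
    refine ⟨Real.arccos (x / 2), ⟨Real.arccos_nonneg _, Real.arccos_le_pi _⟩, ?_⟩
    rw [Real.cos_arccos (by linarith [hx.1]) (by linarith [hx.2])]
    congr 1; ring
  · rintro ⟨θ, -, rfl⟩
    exact ⟨_, ⟨by linarith [Real.neg_one_le_cos θ], by linarith [Real.cos_le_one θ]⟩, rfl⟩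

theorem log_edist_of_ne {z y : ℂ} (h : z ≠ y) :
    ENNReal.log (edist z y) = (Real.log ‖z - y‖ : EReal) := by
  rw [edist_dist, dist_eq_norm, ENNReal.log_ofReal_of_pos (norm_pos_iff.2 (sub_ne_zero.2 h))]

theorem norm_sub_le_four {z y : ℂ} (hz : z ∈ interval) (hy : y ∈ interval) : ‖z - y‖ ≤ 4 := by
  obtain ⟨a, ha, rfl⟩ := hz
  obtain ⟨b, hb, rfl⟩ := hy
  rw [← Complex.ofReal_sub, Complex.norm_real, Real.norm_eq_abs, abs_le]
  constructor <;> linarith [ha.1, ha.2, hb.1, hb.2]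

/-- The diameter 4 bounds the positive part of the kernel, so energies never take the form ∞ - ∞. -/
theorem toENNReal_log_edist_le {z y : ℂ} (hz : z ∈ interval) (hy : y ∈ interval) :
    (ENNReal.log (edist z y)).toENNReal ≤ ENNReal.ofReal (Real.log 4) := by
  rw [← EReal.real_coe_toENNReal, ← ENNReal.log_ofReal_of_pos (by norm_num)]
  refine EReal.toENNReal_le_toENNReal (ENNReal.log_le_log ?_)
  rw [edist_dist, dist_eq_norm]
  exact ENNReal.ofReal_le_ofReal (norm_sub_le_four hz hy)

/-- The uniform probability measure on the angles `(0, 2π]`. -/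
noncomputable def angleMeasure : Measure ℝ :=
  (ENNReal.ofReal (2 * Real.pi))⁻¹ • volume.restrict (Set.Ioc 0 (2 * Real.pi))

/-- The arcsine distribution of `[-2, 2]`, as a measure on `ℂ`: the law of `2 cos θ` for a
uniformly distributed angle `θ`. -/
noncomputable def arcsine : Measure ℂ :=
  angleMeasure.map fun θ => ((2 * Real.cos θ : ℝ) : ℂ)

instance : IsProbabilityMeasure angleMeasure := by
  constructor
  have h0 : ENNReal.ofReal (2 * Real.pi) ≠ 0 := by
    rw [Ne, ENNReal.ofReal_eq_zero, not_le]; positivity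
  simp only [angleMeasure, Measure.smul_apply, Measure.restrict_apply_univ, Real.volume_Ioc,
    sub_zero, smul_eq_mul]
  exact ENNReal.inv_mul_cancel h0 ENNReal.ofReal_ne_top

theorem continuous_two_cos : Continuous fun θ : ℝ => ((2 * Real.cos θ : ℝ) : ℂ) := by fun_prop

instance : IsProbabilityMeasure arcsine :=
  Measure.isProbabilityMeasure_map continuous_two_cos.aemeasurable

/-- Fibres of the cosine are countable. Without atoms, log|y - z| is a genuine logarithm for almost
every y, and zeros of polynomials are negligible. -/
instance : NullSingletonClass arcsine := by
  constructor
  intro z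
  rw [arcsine, Measure.map_apply continuous_two_cos.measurable (measurableSet_singleton z)]
  have hc : ((fun θ : ℝ => ((2 * Real.cos θ : ℝ) : ℂ)) ⁻¹' {z}).Countable := by
    rcases Set.eq_empty_or_nonempty ((fun θ : ℝ => ((2 * Real.cos θ : ℝ) : ℂ)) ⁻¹' {z}) with h | ⟨a, ha⟩
    · rw [h]; exact Set.countable_empty
    · refine ((Set.countable_range fun k : ℤ => 2 * k * Real.pi + a).union
        (Set.countable_range fun k : ℤ => 2 * k * Real.pi - a)).mono ?_
      intro θ hθ
      simp only [Set.mem_preimage, Set.mem_singleton_iff] at ha hθ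
      have : Real.cos a = Real.cos θ := by
        have := ha.trans hθ.symm
        have := Complex.ofReal_injective this
        linarith
      obtain ⟨k, hk | hk⟩ := Real.cos_eq_cos_iff.1 this
      · exact Or.inl ⟨k, hk.symm⟩
      · exact Or.inr ⟨k, hk.symm⟩
  rw [angleMeasure, Measure.smul_apply, smul_eq_mul,
    Measure.restrict_apply (continuous_two_cos.measurable (measurableSet_singleton z)),
    (hc.mono Set.inter_subset_left).measure_zero, mul_zero]

theorem arcsine_compl_interval : arcsine intervalᶜ = 0 := by
  rw [arcsine, Measure.map_apply continuous_two_cos.measurable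
    isCompact_interval.isClosed.measurableSet.compl]
  convert measure_empty (μ := angleMeasure)
  ext θ
  simp only [Set.mem_preimage, Set.mem_compl_iff, Set.mem_empty_iff_false, iff_false, not_not]
  exact ⟨_, ⟨by linarith [Real.neg_one_le_cos θ], by linarith [Real.cos_le_one θ]⟩, rfl⟩

theorem arcsine_mem_probOn : arcsine ∈ probOn interval :=
  ⟨inferInstance, arcsine_compl_interval⟩

theorem support_arcsine : arcsine.support = interval := by
  refine Set.Subset.antisymm
    (Measure.support_subset_of_isClosed isCompact_interval.isClosed arcsine_compl_interval) ?_
  intro z hz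
  obtain ⟨a, ha, rfl⟩ := mem_interval_iff_exists_angle.1 hz
  rw [Measure.mem_support_iff_forall]
  intro U hU
  obtain ⟨V, hVU, hV, haV⟩ := mem_nhds_iff.1 hU
  refine lt_of_lt_of_le ?_ (measure_mono hVU)
  rw [arcsine, Measure.map_apply continuous_two_cos.measurable hV.measurableSet, angleMeasure,
    Measure.smul_apply, smul_eq_mul, Measure.restrict_apply
      (continuous_two_cos.measurable hV.measurableSet)]
  set O := (fun θ : ℝ => ((2 * Real.cos θ : ℝ) : ℂ)) ⁻¹' V
  have hO : IsOpen O := hV.preimage continuous_two_cos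
  have hpi := Real.pi_pos
  -- The angle `a` may be the endpoint 0, so only membership in the closure is available.
  have hcl : a ∈ closure (Set.Ioo 0 (2 * Real.pi)) := by
    rw [closure_Ioo (by positivity)]
    exact ⟨ha.1, by linarith [ha.2]⟩
  have hne : (O ∩ Set.Ioo 0 (2 * Real.pi)).Nonempty := mem_closure_iff.1 hcl O hO haV
  refine ENNReal.mul_pos (ENNReal.inv_ne_zero.2 ENNReal.ofReal_ne_top) (ne_of_gt ?_)
  exact ((hO.inter isOpen_Ioo).measure_pos volume hne).trans_le
    (measure_mono (Set.inter_subset_inter_right _ Set.Ioo_subset_Ioc_self))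

/-! ### Joukowsky coordinate and the arcsine potential. -/

theorem exists_add_inv_eq (z : ℂ) : ∃ w : ℂ, w ≠ 0 ∧ w + w⁻¹ = z := by
  obtain ⟨s, hs⟩ := IsAlgClosed.exists_pow_nat_eq (z ^ 2 - 4) (n := 2) two_pos
  have h : (z + s) / 2 * ((z - s) / 2) = 1 := by linear_combination -hs / 4
  refine ⟨(z + s) / 2, left_ne_zero_of_mul_eq_one h, ?_⟩
  rw [inv_eq_of_mul_eq_one_right h]
  ring

/-- For ζ on the unit circle, ζ + 1/ζ - w - 1/w = (ζ - w)(ζ - 1/w)/ζ. This reduces the potential to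
circle averages of log|ζ - a|. -/
theorem norm_two_cos_sub {w : ℂ} (hw : w ≠ 0) (θ : ℝ) :
    ‖((2 * Real.cos θ : ℝ) : ℂ) - (w + w⁻¹)‖ = ‖circleMap 0 1 θ - w‖ * ‖circleMap 0 1 θ - w⁻¹‖ := by
  set ζ := circleMap 0 1 θ with hζ
  have h1 : ‖ζ‖ = 1 := by simp [hζ]
  have h0 : ζ ≠ 0 := by intro h; simp [h] at h1
  have h2 : ((2 * Real.cos θ : ℝ) : ℂ) = ζ + ζ⁻¹ := by
    rw [hζ, circleMap_zero, Complex.ofReal_one, one_mul, ← Complex.exp_neg]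
    push_cast
    rw [Complex.two_cos]
    ring_nf
  rw [h2, ← norm_mul, ← one_mul ‖ζ + ζ⁻¹ - _‖, ← h1, ← norm_mul]
  congr 1
  field_simp
  ring

theorem arcsine_ae_ne (z : ℂ) : ∀ᵐ y ∂arcsine, y ≠ z := by
  rw [ae_iff]
  simp

theorem angleMeasure_ae_two_cos_ne (z : ℂ) :
    ∀ᵐ θ ∂angleMeasure, ((2 * Real.cos θ : ℝ) : ℂ) ≠ z :=
  ae_of_ae_map continuous_two_cos.aemeasurable (arcsine_ae_ne z)

theorem integrable_angleMeasure_iff {f : ℝ → ℝ} :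
    Integrable f angleMeasure ↔ IntervalIntegrable f volume 0 (2 * Real.pi) := by
  rw [intervalIntegrable_iff_integrableOn_Ioc_of_le Real.two_pi_pos.le, angleMeasure,
    integrable_smul_measure (ENNReal.inv_ne_zero.2 ENNReal.ofReal_ne_top)]
  · rfl
  · rw [Ne, ENNReal.inv_eq_top, ENNReal.ofReal_eq_zero, not_le]; exact Real.two_pi_pos

theorem integral_angleMeasure (f : ℂ → ℝ) :
    ∫ θ, f (circleMap 0 1 θ) ∂angleMeasure = Real.circleAverage f 0 1 := by
  rw [Real.circleAverage_def, intervalIntegral.integral_of_le Real.two_pi_pos.le, angleMeasure,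
    integral_smul_measure, ENNReal.toReal_inv, ENNReal.toReal_ofReal Real.two_pi_pos.le]

/-- The logarithmic potential of the arcsine distribution, in the Joukowsky coordinate. -/
theorem integral_log_norm_sub_arcsine {w : ℂ} (hw : w ≠ 0) :
    Integrable (fun y => Real.log ‖y - (w + w⁻¹)‖) arcsine ∧
      ∫ y, Real.log ‖y - (w + w⁻¹)‖ ∂arcsine = Real.posLog ‖w‖ + Real.posLog ‖w⁻¹‖ := by
  have hm : Measurable fun y : ℂ => Real.log ‖y - (w + w⁻¹)‖ := by fun_prop
  have hae : (fun θ : ℝ => Real.log ‖((2 * Real.cos θ : ℝ) : ℂ) - (w + w⁻¹)‖) =ᵐ[angleMeasure]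
      fun θ => Real.log ‖circleMap 0 1 θ - w‖ + Real.log ‖circleMap 0 1 θ - w⁻¹‖ := by
    filter_upwards [angleMeasure_ae_two_cos_ne (w + w⁻¹)] with θ hθ
    have hn := norm_two_cos_sub hw θ
    have h0 : ‖circleMap 0 1 θ - w‖ * ‖circleMap 0 1 θ - w⁻¹‖ ≠ 0 := by
      rw [← hn]; exact norm_ne_zero_iff.2 (sub_ne_zero.2 hθ)
    rw [hn, Real.log_mul (left_ne_zero_of_mul h0) (right_ne_zero_of_mul h0)]
  have hi (a : ℂ) : Integrable (fun θ => Real.log ‖circleMap 0 1 θ - a‖) angleMeasure :=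
    integrable_angleMeasure_iff.2 (circleIntegrable_log_norm_sub_const 1)
  have hv (a : ℂ) : ∫ θ, Real.log ‖circleMap 0 1 θ - a‖ ∂angleMeasure = Real.posLog ‖a‖ := by
    rw [integral_angleMeasure (fun z => Real.log ‖z - a‖)]
    exact circleAverage_log_norm_sub_const_eq_posLog
  constructor
  · rw [arcsine, integrable_map_measure hm.aestronglyMeasurable continuous_two_cos.aemeasurable]
    exact ((hi w).add (hi w⁻¹)).congr hae.symm
  · rw [arcsine, integral_map continuous_two_cos.aemeasurable hm.aestronglyMeasurable,
      integral_congr_ae hae, integral_add (hi _) (hi _), hv, hv]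

theorem integrable_log_norm_sub_arcsine (z : ℂ) :
    Integrable (fun y => Real.log ‖y - z‖) arcsine := by
  obtain ⟨w, hw, rfl⟩ := exists_add_inv_eq z
  exact (integral_log_norm_sub_arcsine hw).1

theorem integral_log_norm_sub_arcsine_nonneg (z : ℂ) :
    0 ≤ ∫ y, Real.log ‖y - z‖ ∂arcsine := by
  obtain ⟨w, hw, rfl⟩ := exists_add_inv_eq z
  rw [(integral_log_norm_sub_arcsine hw).2]
  exact add_nonneg Real.posLog_nonneg Real.posLog_nonneg

/-- Points of the interval have |w| = 1, so both positive logarithms vanish. -/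
theorem integral_log_norm_sub_arcsine_of_mem {z : ℂ} (hz : z ∈ interval) :
    ∫ y, Real.log ‖y - z‖ ∂arcsine = 0 := by
  obtain ⟨θ, -, rfl⟩ := mem_interval_iff_exists_angle.1 hz
  have h0 : Complex.exp (θ * Complex.I) ≠ 0 := Complex.exp_ne_zero _
  have h : ((2 * Real.cos θ : ℝ) : ℂ) =
      Complex.exp (θ * Complex.I) + (Complex.exp (θ * Complex.I))⁻¹ := by
    rw [← Complex.exp_neg]
    push_cast
    rw [Complex.two_cos]
    ring_nf
  rw [h, (integral_log_norm_sub_arcsine h0).2, norm_inv, Complex.norm_exp_ofReal_mul_I]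
  simp

/-- The logarithmic energy of the arcsine distribution vanishes. -/
theorem logEnergy_arcsine : logEnergy arcsine = 0 := by
  have hm : Measurable fun q : ℂ × ℂ => ENNReal.log (edist q.1 q.2) :=
    (measurable_fst.edist measurable_snd).ennreal_log
  have hm' : Measurable fun q : ℂ × ℂ => -ENNReal.log (edist q.1 q.2) := hm.neg
  have hae : ∀ᵐ z ∂arcsine, z ∈ interval := arcsine_compl_interval
  -- A zero potential means that positive and negative parts have equal integrals for each z.
  -- Tonelli applies to each part separately, and the bound log 4 makes the common value finite.
  have key : ∀ z ∈ interval,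
      ∫⁻ y, (ENNReal.log (edist z y)).toENNReal ∂arcsine =
        ∫⁻ y, (-ENNReal.log (edist z y)).toENNReal ∂arcsine ∧
      ∫⁻ y, (ENNReal.log (edist z y)).toENNReal ∂arcsine ≤ ENNReal.ofReal (Real.log 4) := by
    intro z hz
    have hφ := integrable_log_norm_sub_arcsine z
    have hlog : ∀ᵐ y ∂arcsine, ENNReal.log (edist z y) = (Real.log ‖z - y‖ : EReal) := by
      filter_upwards [arcsine_ae_ne z] with y hy using log_edist_of_ne hy.symm
    simp_rw [norm_sub_rev _ z] at hφ
    have h0 : ∫ y, Real.log ‖z - y‖ ∂arcsine = 0 := by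
      simp_rw [norm_sub_rev z]
      exact integral_log_norm_sub_arcsine_of_mem hz
    have h1 : ∫⁻ y, (ENNReal.log (edist z y)).toENNReal ∂arcsine =
        ∫⁻ y, ENNReal.ofReal (Real.log ‖z - y‖) ∂arcsine :=
      lintegral_congr_ae (hlog.mono fun y hy => by simp only [hy, EReal.real_coe_toENNReal])
    have h2 : ∫⁻ y, (-ENNReal.log (edist z y)).toENNReal ∂arcsine =
        ∫⁻ y, ENNReal.ofReal (-Real.log ‖z - y‖) ∂arcsine :=
      lintegral_congr_ae (hlog.mono fun y hy => by
        simp only [hy, ← EReal.coe_neg, EReal.real_coe_toENNReal])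
    constructor
    · rw [integral_eq_lintegral_pos_part_sub_lintegral_neg_part hφ, sub_eq_zero] at h0
      rw [h1, h2]
      exact (ENNReal.toReal_eq_toReal_iff' hφ.lintegral_lt_top.ne
        hφ.neg.lintegral_lt_top.ne).1 h0
    · refine (lintegral_mono_ae (g := fun _ => ENNReal.ofReal (Real.log 4)) ?_).trans (by simp)
      exact hae.mono fun y hy => toENNReal_log_edist_le hz hy
  have e : ∫⁻ q, (ENNReal.log (edist q.1 q.2)).toENNReal ∂(arcsine.prod arcsine) =
      ∫⁻ q, (-ENNReal.log (edist q.1 q.2)).toENNReal ∂(arcsine.prod arcsine) := by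
    rw [lintegral_prod _ hm.ereal_toENNReal.aemeasurable,
      lintegral_prod _ hm'.ereal_toENNReal.aemeasurable]
    exact lintegral_congr_ae (hae.mono fun z hz => (key z hz).1)
  have f : ∫⁻ q, (ENNReal.log (edist q.1 q.2)).toENNReal ∂(arcsine.prod arcsine) ≠ ⊤ := by
    rw [lintegral_prod _ hm.ereal_toENNReal.aemeasurable]
    refine ne_top_of_le_ne_top ?_ (lintegral_mono_ae (hae.mono fun z hz => (key z hz).2))
    simp
  rw [logEnergy, extIntegral, ← e]
  exact EReal.sub_self (by simpa using f) (by simp)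

/-! ### Chebyshev expansion and the energy bound. -/

/-- The angle `θ ∈ [0, π]` with `re z = 2 cos θ`. -/
noncomputable def angle (z : ℂ) : ℝ := Real.arccos (z.re / 2)

theorem continuous_angle : Continuous angle :=
  Real.continuous_arccos.comp (by fun_prop)

theorem eq_two_cos_angle {z : ℂ} (hz : z ∈ interval) : z = ((2 * Real.cos (angle z) : ℝ) : ℂ) := by
  obtain ⟨x, hx, rfl⟩ := hz
  rw [angle, Complex.ofReal_re, Real.cos_arccos (by linarith [hx.1]) (by linarith [hx.2])]
  congr 1; ring

/-- Real part of the Taylor series of -log(1 - r e^{iα}); the term k = 0 is 0 since division by zero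
gives 0. -/
theorem hasSum_pow_mul_cos {r : ℝ} (h0 : 0 ≤ r) (h1 : r < 1) (α : ℝ) :
    HasSum (fun k : ℕ => r ^ k / k * Real.cos (k * α))
      (-(Real.log (1 - 2 * r * Real.cos α + r ^ 2) / 2)) := by
  have hz : ‖(r : ℂ) * Complex.exp (α * Complex.I)‖ < 1 := by
    rw [norm_mul, Complex.norm_exp_ofReal_mul_I, mul_one, Complex.norm_real, Real.norm_of_nonneg h0]
    exact h1
  have h := Complex.hasSum_re (Complex.hasSum_taylorSeries_neg_log hz)
  have hn : ‖1 - (r : ℂ) * Complex.exp (α * Complex.I)‖ ^ 2 = 1 - 2 * r * Real.cos α + r ^ 2 := by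
    rw [← Complex.normSq_eq_norm_sq, Complex.exp_mul_I, ← Complex.ofReal_cos, ← Complex.ofReal_sin,
      Complex.normSq_apply]
    simp [Complex.cos_ofReal_re, Complex.sin_ofReal_re]
    linear_combination r ^ 2 * Real.sin_sq_add_cos_sq α
  convert h using 1
  · funext k
    have : ((r : ℂ) * Complex.exp (α * Complex.I)) ^ k / (k : ℂ) =
        ((r ^ k / k : ℝ) : ℂ) * Complex.exp ((k * α : ℝ) * Complex.I) := by
      rw [mul_pow, ← Complex.exp_nat_mul]
      push_cast
      ring_nf
    rw [this, Complex.re_ofReal_mul, Complex.exp_ofReal_mul_I_re]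
  · rw [Complex.neg_re, Complex.log_re, ← hn, Real.log_pow]
    push_cast
    ring

/-- The Abel means of the Chebyshev expansion of `-log |2 cos θ - 2 cos φ|`. -/
noncomputable def abelKernel (r θ φ : ℝ) : ℝ :=
  -(Real.log (1 - 2 * r * Real.cos (θ - φ) + r ^ 2) / 2) +
    -(Real.log (1 - 2 * r * Real.cos (θ + φ) + r ^ 2) / 2)

theorem hasSum_abelKernel {r : ℝ} (h0 : 0 ≤ r) (h1 : r < 1) (θ φ : ℝ) :
    HasSum (fun k : ℕ => 2 * r ^ k / k * (Real.cos (k * θ) * Real.cos (k * φ)))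
      (abelKernel r θ φ) := by
  convert (hasSum_pow_mul_cos h0 h1 (θ - φ)).add (hasSum_pow_mul_cos h0 h1 (θ + φ)) using 1
  swap
  · rfl
  funext k
  rw [mul_sub, mul_add, Real.cos_sub, Real.cos_add]
  ring

/-- Each factor loses only (1 - r)²: 1 - 2r cos α + r² = r(2 - 2 cos α) + (1 - r)². Taking α = θ ± φ
gives a pointwise one-sided comparison whose error -log r vanishes as r → 1, so no exchange of limit
and integral is needed. -/
theorem log_norm_two_cos_sub_le {r : ℝ} (h0 : 0 < r) (h1 : r < 1) {θ φ : ℝ}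
    (h : Real.cos θ ≠ Real.cos φ) :
    Real.log ‖((2 * Real.cos θ : ℝ) : ℂ) - ((2 * Real.cos φ : ℝ) : ℂ)‖ ≤
      -Real.log r - abelKernel r θ φ := by
  have D (α : ℝ) : 0 < 1 - 2 * r * Real.cos α + r ^ 2 := by
    nlinarith [Real.cos_le_one α, mul_nonneg h0.le (sub_nonneg.2 (Real.cos_le_one α)),
      pow_pos (sub_pos.2 h1) 2]
  have E (α : ℝ) : r * (2 - 2 * Real.cos α) ≤ 1 - 2 * r * Real.cos α + r ^ 2 := by
    nlinarith [sq_nonneg (1 - r)]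
  have F (α : ℝ) : 0 ≤ 2 - 2 * Real.cos α := by linarith [Real.cos_le_one α]
  have hid : (2 * Real.cos θ - 2 * Real.cos φ) ^ 2 =
      (2 - 2 * Real.cos (θ - φ)) * (2 - 2 * Real.cos (θ + φ)) := by
    rw [Real.cos_sub, Real.cos_add]
    nlinarith [Real.sin_sq_add_cos_sq θ, Real.sin_sq_add_cos_sq φ]
  have hne : 2 * Real.cos θ - 2 * Real.cos φ ≠ 0 := by
    intro H; exact h (by linarith)
  have hle : r ^ 2 * (2 * Real.cos θ - 2 * Real.cos φ) ^ 2 ≤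
      (1 - 2 * r * Real.cos (θ - φ) + r ^ 2) * (1 - 2 * r * Real.cos (θ + φ) + r ^ 2) := by
    rw [hid]
    calc _ = (r * (2 - 2 * Real.cos (θ - φ))) * (r * (2 - 2 * Real.cos (θ + φ))) := by ring
      _ ≤ _ := mul_le_mul (E _) (E _) (mul_nonneg h0.le (F _)) (D _).le
  have hlog := Real.log_le_log (by positivity) hle
  rw [Real.log_mul (by positivity) (by positivity), Real.log_mul (D _).ne' (D _).ne',
    Real.log_pow, Real.log_pow] at hlog
  rw [← Complex.ofReal_sub, Complex.norm_real, Real.norm_eq_abs, Real.log_abs, abelKernel]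
  push_cast at hlog
  linarith

theorem continuous_cos_mul_angle (k : ℕ) : Continuous fun z => Real.cos (k * angle z) :=
  Real.continuous_cos.comp (continuous_const.mul continuous_angle)

/-- The Chebyshev moments of a measure on `[-2, 2]`. -/
noncomputable def chebyshevMoment (ν : Measure ℂ) (k : ℕ) : ℝ :=
  ∫ z, Real.cos (k * angle z) ∂ν

theorem abs_term_le {r : ℝ} (h0 : 0 ≤ r) (k : ℕ) (θ φ : ℝ) :
    ‖2 * r ^ k / k * (Real.cos (k * θ) * Real.cos (k * φ))‖ ≤ 2 * r ^ k := by
  rw [norm_mul, norm_mul, Real.norm_eq_abs, Real.norm_eq_abs, Real.norm_eq_abs,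
    abs_of_nonneg (by positivity)]
  have hk : 2 * r ^ k / k ≤ 2 * r ^ k := by
    rcases Nat.eq_zero_or_pos k with rfl | hk
    · simp
    · exact div_le_self (by positivity) (by exact_mod_cast hk)
  calc _ ≤ 2 * r ^ k / k * (1 * 1) := by
        gcongr <;> exact Real.abs_cos_le_one _
    _ ≤ _ := by simpa using hk

theorem integrable_abelKernel (ν : Measure ℂ) [IsProbabilityMeasure ν] {r : ℝ} (h0 : 0 < r)
    (h1 : r < 1) :
    Integrable (fun q : ℂ × ℂ => abelKernel r (angle q.1) (angle q.2)) (ν.prod ν) := by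
  have hm : Measurable fun q : ℂ × ℂ => abelKernel r (angle q.1) (angle q.2) := by
    have := continuous_angle.measurable
    unfold abelKernel
    fun_prop
  refine Integrable.of_bound hm.aestronglyMeasurable (2 * (1 - r)⁻¹) (ae_of_all _ fun q => ?_)
  rw [← (hasSum_abelKernel h0.le h1 (angle q.1) (angle q.2)).tsum_eq]
  exact tsum_of_norm_bounded ((hasSum_geometric_of_lt_one h0.le h1).mul_left 2)
    fun k => abs_term_le h0.le k _ _

/-- Integrating the expansion termwise gives a series of nonnegative terms 2 r^k/k · m_k², of which
one is kept. -/
theorem le_integral_abelKernel (ν : Measure ℂ) [IsProbabilityMeasure ν] {r : ℝ} (h0 : 0 < r)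
    (h1 : r < 1) (k : ℕ) :
    2 * r ^ k / k * chebyshevMoment ν k ^ 2 ≤
      ∫ q : ℂ × ℂ, abelKernel r (angle q.1) (angle q.2) ∂(ν.prod ν) := by
  set F : ℕ → ℂ × ℂ → ℝ := fun k q =>
    2 * r ^ k / k * (Real.cos (k * angle q.1) * Real.cos (k * angle q.2)) with hF
  have hFm (k : ℕ) : Measurable (F k) := by
    have := (continuous_cos_mul_angle k).measurable
    exact ((this.comp measurable_fst).mul (this.comp measurable_snd)).const_mul _
  have hFb (k : ℕ) (q : ℂ × ℂ) : ‖F k q‖ ≤ 2 * r ^ k := abs_term_le h0.le k _ _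
  have hFi (k : ℕ) : Integrable (F k) (ν.prod ν) :=
    Integrable.of_bound (hFm k).aestronglyMeasurable (2 * r ^ k) (ae_of_all _ (hFb k))
  have hgeom : Summable fun k : ℕ => 2 * r ^ k := (summable_geometric_of_lt_one h0.le h1).mul_left 2
  have hsum : Summable fun k => ∫ q, ‖F k q‖ ∂(ν.prod ν) := by
    refine Summable.of_nonneg_of_le (fun k => integral_nonneg fun q => norm_nonneg _) (fun k => ?_)
      hgeom
    calc _ ≤ ∫ _q, 2 * r ^ k ∂(ν.prod ν) :=
          integral_mono (hFi k).norm (integrable_const _) (hFb k)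
      _ = _ := by simp
  have H := hasSum_integral_of_summable_integral_norm hFi hsum
  have hval (k : ℕ) : ∫ q, F k q ∂(ν.prod ν) = 2 * r ^ k / k * chebyshevMoment ν k ^ 2 := by
    rw [hF, integral_const_mul, integral_prod_mul (μ := ν) (ν := ν)
      (fun z => Real.cos (k * angle z)) (fun z => Real.cos (k * angle z)), chebyshevMoment, sq]
  have htsum (q : ℂ × ℂ) : ∑' k, F k q = abelKernel r (angle q.1) (angle q.2) :=
    (hasSum_abelKernel h0.le h1 _ _).tsum_eq
  simp only [hval, htsum] at H
  exact le_hasSum H k fun j _ => by positivity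

/-- Integrate the comparison with the Abel kernel and let r → 1. For k = 0 the coefficient 2/0 is 0,
so that case reads as energy ≤ 0. -/
theorem logEnergy_le {ν : Measure ℂ} (hν : ν ∈ probOn interval) (k : ℕ) :
    logEnergy ν ≤ ((-(2 / k * chebyshevMoment ν k ^ 2) : ℝ) : EReal) := by
  obtain ⟨_, hν⟩ := hν
  rcases eq_bot_or_bot_lt (logEnergy ν) with hb | hb
  · rw [hb]; exact bot_le
  have hae : ∀ᵐ z ∂ν, z ∈ interval := hν
  have hae1 : ∀ᵐ q ∂(ν.prod ν), q.1 ∈ interval := Measure.quasiMeasurePreserving_fst.ae hae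
  have hae2 : ∀ᵐ q ∂(ν.prod ν), q.2 ∈ interval := Measure.quasiMeasurePreserving_snd.ae hae
  have hm : Measurable fun q : ℂ × ℂ => ENNReal.log (edist q.1 q.2) :=
    (measurable_fst.edist measurable_snd).ennreal_log
  have hpos : ∫⁻ q, (ENNReal.log (edist q.1 q.2)).toENNReal ∂(ν.prod ν) ≠ ⊤ := by
    refine ne_top_of_le_ne_top (b := ENNReal.ofReal (Real.log 4)) (by simp)
      ((lintegral_mono_ae (g := fun _ => ENNReal.ofReal (Real.log 4)) ?_).trans (by simp))
    filter_upwards [hae1, hae2] with q h1 h2 using toENNReal_log_edist_le h1 h2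
  obtain ⟨hint, hlog⟩ := exists_integrable_of_bot_lt_extIntegral hm hpos hb
  rw [logEnergy, extIntegral_congr_ae hlog, extIntegral_coe hint, EReal.coe_le_coe_iff]
  have hr : ∀ r ∈ Set.Ioo (0 : ℝ) 1, ∫ q, (ENNReal.log (edist q.1 q.2)).toReal ∂(ν.prod ν) ≤
      -Real.log r - 2 * r ^ k / k * chebyshevMoment ν k ^ 2 := by
    rintro r ⟨h0, h1⟩
    have hA := integrable_abelKernel ν h0 h1
    calc _ ≤ ∫ q : ℂ × ℂ, (-Real.log r - abelKernel r (angle q.1) (angle q.2)) ∂(ν.prod ν) := by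
          refine integral_mono_ae hint ((integrable_const _).sub hA) ?_
          filter_upwards [hae1, hae2, hlog] with q hq1 hq2 hq
          -- Finite energy makes the kernel real-valued almost everywhere, which excludes the
          -- diagonal.
          have hne : q.1 ≠ q.2 := by
            intro H
            rw [H, edist_self, ENNReal.log_zero] at hq
            exact EReal.bot_ne_coe _ hq
          rw [log_edist_of_ne hne, EReal.toReal_coe]
          have e1 := eq_two_cos_angle hq1
          have e2 := eq_two_cos_angle hq2
          have := log_norm_two_cos_sub_le h0 h1 (θ := angle q.1) (φ := angle q.2) (by
            intro H; apply hne; rw [e1, e2, H])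
          rwa [← e1, ← e2] at this
      _ = -Real.log r - ∫ q : ℂ × ℂ, abelKernel r (angle q.1) (angle q.2) ∂(ν.prod ν) := by
          rw [integral_sub (integrable_const _) hA]; simp
      _ ≤ _ := sub_le_sub_left (le_integral_abelKernel ν h0 h1 k) _
  have hc : ContinuousAt (fun r : ℝ => -Real.log r - 2 * r ^ k / k * chebyshevMoment ν k ^ 2) 1 := by
    have := Real.continuousAt_log (one_ne_zero)
    fun_prop
  have ht := hc.tendsto.mono_left (nhdsWithin_le_nhds (s := Set.Iio 1))
  have := ge_of_tendsto ht (Filter.eventually_of_mem (Ioo_mem_nhdsLT (zero_lt_one' ℝ)) hr)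
  simpa using this

/-! ### Chebyshev moments determine the measure. -/

section Uniqueness

variable (ν : Measure ℂ) [IsProbabilityMeasure ν]

theorem integrable_comp_cos_angle {g : ℝ → ℝ} (hg : Continuous g) :
    Integrable (fun z => g (Real.cos (angle z))) ν := by
  obtain ⟨C, hC⟩ := (isCompact_Icc (a := (-1 : ℝ)) (b := 1)).exists_bound_of_continuousOn
    hg.continuousOn
  have hc : Continuous fun z => g (Real.cos (angle z)) :=
    hg.comp (Real.continuous_cos.comp continuous_angle)
  exact Integrable.of_bound hc.aestronglyMeasurable C
    (ae_of_all _ fun z => hC _ (Real.cos_mem_Icc _))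

/-- Induction through X T_k = (T_{k+1} + T_{k-1})/2. The index k is an integer because k - 1 may be
negative, where T_{-k} = T_k; the case k = 0 yields the power moments. -/
theorem integral_pow_mul_chebyshev_eq {ν' : Measure ℂ} [IsProbabilityMeasure ν']
    (h : ∀ k, chebyshevMoment ν k = chebyshevMoment ν' k) (m : ℕ) (k : ℤ) :
    ∫ z, (X ^ m * Chebyshev.T ℝ k).eval (Real.cos (angle z)) ∂ν =
      ∫ z, (X ^ m * Chebyshev.T ℝ k).eval (Real.cos (angle z)) ∂ν' := by
  induction m generalizing k with
  | zero =>
    have hk (k : ℕ) : ∫ z, (Chebyshev.T ℝ k).eval (Real.cos (angle z)) ∂ν =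
        ∫ z, (Chebyshev.T ℝ k).eval (Real.cos (angle z)) ∂ν' := by
      simpa [Chebyshev.T_real_cos, chebyshevMoment] using h k
    simp only [pow_zero, one_mul]
    rcases Int.eq_nat_or_neg k with ⟨j, rfl | rfl⟩
    · exact hk j
    · simpa only [Chebyshev.T_neg] using hk j
  | succ m ih =>
    have e : (X ^ (m + 1) * Chebyshev.T ℝ k : ℝ[X]) =
        C (1 / 2) * (X ^ m * Chebyshev.T ℝ (k + 1) + X ^ m * Chebyshev.T ℝ (k - 1)) := by
      have hC : (C (1 / 2) * 2 : ℝ[X]) = 1 := by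
        rw [← C_ofNat, ← C_mul]; norm_num
      rw [Chebyshev.T_add_one]
      linear_combination (-(X ^ (m + 1) * Chebyshev.T ℝ k)) * hC
    simp only [e, eval_mul (p := C _), eval_add, eval_C, integral_const_mul]
    rw [integral_add (integrable_comp_cos_angle ν (Polynomial.continuous _))
        (integrable_comp_cos_angle ν (Polynomial.continuous _)),
      integral_add (integrable_comp_cos_angle ν' (Polynomial.continuous _))
        (integrable_comp_cos_angle ν' (Polynomial.continuous _)), ih, ih]

theorem integral_polynomial_cos_angle_eq {ν' : Measure ℂ} [IsProbabilityMeasure ν']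
    (h : ∀ k, chebyshevMoment ν k = chebyshevMoment ν' k) (p : ℝ[X]) :
    ∫ z, p.eval (Real.cos (angle z)) ∂ν = ∫ z, p.eval (Real.cos (angle z)) ∂ν' := by
  induction p using Polynomial.induction_on' with
  | add p q hp hq =>
    simp only [eval_add]
    rw [integral_add (integrable_comp_cos_angle ν p.continuous)
        (integrable_comp_cos_angle ν q.continuous),
      integral_add (integrable_comp_cos_angle ν' p.continuous)
        (integrable_comp_cos_angle ν' q.continuous), hp, hq]
  | monomial m a =>
    have := integral_pow_mul_chebyshev_eq ν h m 0
    simp only [Chebyshev.T_zero, mul_one, eval_pow, eval_X] at this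
    simp only [eval_monomial, integral_const_mul, this]

/-- A probability measure on `[-2, 2]` is determined by its Chebyshev moments. -/
theorem eq_of_chebyshevMoment_eq {ν' : Measure ℂ} [IsProbabilityMeasure ν']
    (hν : ν intervalᶜ = 0) (hν' : ν' intervalᶜ = 0)
    (h : ∀ k, chebyshevMoment ν k = chebyshevMoment ν' k) : ν = ν' := by
  refine ext_of_forall_integral_eq_of_IsFiniteMeasure fun f => ?_
  set g : ℝ → ℝ := fun x => f ((2 * x : ℝ) : ℂ) with hg
  have hgc : Continuous g := f.continuous.comp (by fun_prop)
  have hfg (ρ : Measure ℂ) (hρ : ρ intervalᶜ = 0) :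
      ∫ z, f z ∂ρ = ∫ z, g (Real.cos (angle z)) ∂ρ := by
    have hae : ∀ᵐ z ∂ρ, z ∈ interval := hρ
    refine integral_congr_ae (hae.mono fun z hz => ?_)
    simp only [hg]
    rw [← eq_two_cos_angle hz]
  rw [hfg ν hν, hfg ν' hν', ← sub_eq_zero, ← abs_nonpos_iff]
  refine le_of_forall_pos_le_add fun ε hε => ?_
  obtain ⟨p, hp⟩ := exists_polynomial_near_of_continuousOn (-1) 1 g hgc.continuousOn (ε / 2)
    (half_pos hε)
  have bound (ρ : Measure ℂ) [IsProbabilityMeasure ρ] :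
      |∫ z, p.eval (Real.cos (angle z)) ∂ρ - ∫ z, g (Real.cos (angle z)) ∂ρ| ≤ ε / 2 := by
    rw [← integral_sub (integrable_comp_cos_angle ρ p.continuous)
      (integrable_comp_cos_angle ρ hgc), ← Real.norm_eq_abs]
    simpa using norm_integral_le_of_norm_le_const (μ := ρ) (C := ε / 2)
      (f := fun z => p.eval (Real.cos (angle z)) - g (Real.cos (angle z)))
      (ae_of_all _ fun z => (hp _ (Real.cos_mem_Icc (angle z))).le)
  have b1 := abs_le.1 (bound ν)
  have b2 := abs_le.1 (bound ν')
  have e := integral_polynomial_cos_angle_eq ν h p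
  rw [abs_le]
  constructor <;> linarith [b1.1, b1.2, b2.1, b2.2]

end Uniqueness

/-! ### Equilibrium measure and capacity of the interval. -/

theorem logEnergy_nonpos {ν : Measure ℂ} (hν : ν ∈ probOn interval) : logEnergy ν ≤ 0 := by
  simpa using logEnergy_le hν 0

theorem chebyshevMoment_eq_zero {ν : Measure ℂ} (hν : ν ∈ probOn interval)
    (h : 0 ≤ logEnergy ν) {k : ℕ} (hk : k ≠ 0) : chebyshevMoment ν k = 0 := by
  have h1 := h.trans (logEnergy_le hν k)
  rw [← EReal.coe_zero, EReal.coe_le_coe_iff, neg_nonneg] at h1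
  have hk' : (0 : ℝ) < 2 / k := by positivity
  exact pow_eq_zero_iff two_ne_zero |>.1
    (le_antisymm (nonpos_of_mul_nonpos_right h1 hk') (sq_nonneg _))

/-- Uniqueness is needed because `equilibriumMeasure` is an arbitrary choice among the maximizers.
-/
theorem isEquilibriumMeasure_interval_iff {ν : Measure ℂ} :
    IsEquilibriumMeasure interval ν ↔ ν = arcsine := by
  constructor
  · rintro ⟨hmax, hν⟩
    have h0 : 0 ≤ logEnergy ν := logEnergy_arcsine ▸ hmax arcsine_mem_probOn
    have := hν.1
    refine eq_of_chebyshevMoment_eq ν hν.2 arcsine_compl_interval fun k => ?_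
    rcases eq_or_ne k 0 with rfl | hk
    · simp [chebyshevMoment]
    · rw [chebyshevMoment_eq_zero hν h0 hk,
        chebyshevMoment_eq_zero arcsine_mem_probOn logEnergy_arcsine.ge hk]
  · rintro rfl
    refine ⟨fun ν hν => ?_, arcsine_mem_probOn⟩
    rw [Set.mem_ofPred_eq, logEnergy_arcsine]
    exact logEnergy_nonpos hν

theorem equilibriumMeasure_interval : equilibriumMeasure interval = arcsine := by
  have h : ∃ ν, IsEquilibriumMeasure interval ν :=
    ⟨arcsine, isEquilibriumMeasure_interval_iff.2 rfl⟩
  rw [equilibriumMeasure, dif_pos h]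
  exact isEquilibriumMeasure_interval_iff.1 h.choose_spec

theorem capacity_interval : capacity interval = 1 := by
  have h : ⨆ ν ∈ probOn interval, logEnergy ν = 0 :=
    le_antisymm (iSup₂_le fun ν hν => logEnergy_nonpos hν)
      (logEnergy_arcsine ▸ le_iSup₂ (f := fun ν (_ : ν ∈ probOn interval) => logEnergy ν)
        arcsine arcsine_mem_probOn)
  rw [capacity, h, EReal.exp_zero]

/-! ### The lower bound. -/

/-- Jensen's inequality for the exponential function. -/
theorem ofReal_exp_integral_le_lintegral {α : Type*} [MeasurableSpace α] (ν : Measure α)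
    [IsProbabilityMeasure ν] {φ : α → ℝ} (hφ : Integrable φ ν) :
    ENNReal.ofReal (Real.exp (∫ x, φ x ∂ν)) ≤ ∫⁻ x, ENNReal.ofReal (Real.exp (φ x)) ∂ν := by
  -- Compare exp with its tangent line at the mean `m`. The line may be negative, hence the positive
  -- part before passing to the lower integral.
  set m := ∫ x, φ x ∂ν with hm
  have hi : Integrable (fun x => Real.exp m * (φ x - m + 1)) ν :=
    ((hφ.sub (integrable_const m)).add (integrable_const 1)).const_mul _
  have hs : Integrable (fun x => φ x - m) ν := hφ.sub (integrable_const m)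
  have hv : ∫ x, Real.exp m * (φ x - m + 1) ∂ν = Real.exp m := by
    rw [integral_const_mul, integral_add hs (integrable_const 1),
      integral_sub hφ (integrable_const m)]
    simp [← hm]
  calc ENNReal.ofReal (Real.exp m) = ENNReal.ofReal (∫ x, Real.exp m * (φ x - m + 1) ∂ν) := by
        rw [hv]
    _ ≤ ENNReal.ofReal (∫ x, max (Real.exp m * (φ x - m + 1)) 0 ∂ν) :=
        ENNReal.ofReal_le_ofReal (integral_mono hi hi.pos_part fun x => le_max_left _ _)
    _ = ∫⁻ x, ENNReal.ofReal (max (Real.exp m * (φ x - m + 1)) 0) ∂ν :=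
        ofReal_integral_eq_lintegral_ofReal hi.pos_part (ae_of_all _ fun x => le_max_right _ _)
    _ ≤ _ := by
        refine lintegral_mono fun x => ENNReal.ofReal_le_ofReal
          (max_le ?_ (Real.exp_pos _).le)
        calc _ ≤ Real.exp m * Real.exp (φ x - m) :=
              mul_le_mul_of_nonneg_left (Real.add_one_le_exp _) (Real.exp_pos _).le
          _ = _ := by rw [← Real.exp_add]; congr 1; ring

/-- Each root adds a nonnegative potential. Nonvanishing is carried along the induction because the
logarithm of a product splits only there. -/
theorem integral_log_norm_prod_sub (s : Multiset ℂ) :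
    (∀ᵐ z ∂arcsine, ((s.map fun a => X - C a).prod : ℂ[X]).eval z ≠ 0) ∧
    Integrable (fun z => Real.log ‖((s.map fun a => X - C a).prod : ℂ[X]).eval z‖) arcsine ∧
    0 ≤ ∫ z, Real.log ‖((s.map fun a => X - C a).prod : ℂ[X]).eval z‖ ∂arcsine := by
  induction s using Multiset.induction_on with
  | empty => simp
  | cons a s ih =>
    obtain ⟨h0, hi, hn⟩ := ih
    simp only [Multiset.map_cons, Multiset.prod_cons, eval_mul, eval_sub, eval_X, eval_C, norm_mul]
    have hae : (fun z => Real.log (‖z - a‖ * ‖((s.map fun a => X - C a).prod : ℂ[X]).eval z‖))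
        =ᵐ[arcsine] fun z => Real.log ‖z - a‖ +
          Real.log ‖((s.map fun a => X - C a).prod : ℂ[X]).eval z‖ := by
      filter_upwards [h0, arcsine_ae_ne a] with z h1 h2
      exact Real.log_mul (norm_ne_zero_iff.2 (sub_ne_zero.2 h2)) (norm_ne_zero_iff.2 h1)
    have ha := integrable_log_norm_sub_arcsine a
    refine ⟨?_, (ha.add hi).congr hae.symm, ?_⟩
    · filter_upwards [h0, arcsine_ae_ne a] with z h1 h2
      exact mul_ne_zero (sub_ne_zero.2 h2) h1
    · rw [integral_congr_ae hae, integral_add ha hi]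
      exact add_nonneg (integral_log_norm_sub_arcsine_nonneg a) hn

theorem integral_log_norm_monic {P : ℂ[X]} (hP : P.Monic) :
    (∀ᵐ z ∂arcsine, P.eval z ≠ 0) ∧ Integrable (fun z => Real.log ‖P.eval z‖) arcsine ∧
    0 ≤ ∫ z, Real.log ‖P.eval z‖ ∂arcsine := by
  have h := integral_log_norm_prod_sub P.roots
  rwa [← (IsAlgClosed.splits P).eq_prod_roots_of_monic hP] at h

/-- This bounds ∫ log⁺ f dμ_K by the total mass of μ. -/
theorem toENNReal_log_le (a : ℝ≥0∞) : (ENNReal.log a).toENNReal ≤ a := by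
  rcases eq_or_ne a ⊤ with rfl | ht
  · exact le_top
  rcases eq_or_ne a 0 with rfl | h0
  · simp
  rw [ENNReal.log_pos_real h0 ht, EReal.real_coe_toENNReal]
  exact ENNReal.ofReal_le_of_le_toReal (Real.log_le_self ENNReal.toReal_nonneg)

theorem entropyS_le_lintegral {p : ℝ} (hp : 0 < p) {μ : Measure ℂ} [IsProbabilityMeasure μ]
    (hsupp : μ.support = interval) (hS : 0 < entropyS μ) {P : ℂ[X]} (hP : P.Monic) :
    entropyS μ ≤ ∫⁻ z, ‖P.eval z‖ₑ ^ p ∂μ := by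
  rw [entropyS, hsupp, equilibriumMeasure_interval] at hS ⊢
  have hm : Measurable fun z => ENNReal.log (μ.rnDeriv arcsine z) :=
    (Measure.measurable_rnDeriv _ _).ennreal_log
  have hpos : ∫⁻ z, (ENNReal.log (μ.rnDeriv arcsine z)).toENNReal ∂arcsine ≠ ⊤ :=
    ne_top_of_le_ne_top (measure_ne_top μ Set.univ)
      ((lintegral_mono fun z => toENNReal_log_le _).trans Measure.lintegral_rnDeriv_le)
  obtain ⟨hi, hae⟩ := exists_integrable_of_bot_lt_extIntegral hm hpos (EReal.zero_lt_exp_iff.1 hS)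
  obtain ⟨h0, hPi, hPn⟩ := integral_log_norm_monic hP
  rw [extIntegral_congr_ae hae, extIntegral_coe hi, EReal.exp_coe]
  set φ := fun z => (ENNReal.log (μ.rnDeriv arcsine z)).toReal
  have hPm : Measurable fun z => ‖P.eval z‖ₑ ^ p := P.continuous.measurable.enorm.pow_const p
  calc ENNReal.ofReal (Real.exp (∫ z, φ z ∂arcsine))
      ≤ ENNReal.ofReal (Real.exp (∫ z, (φ z + p * Real.log ‖P.eval z‖) ∂arcsine)) := by
        rw [integral_add hi (hPi.const_mul p), integral_const_mul]
        exact ENNReal.ofReal_le_ofReal (Real.exp_le_exp.2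
          (le_add_of_nonneg_right (mul_nonneg hp.le hPn)))
    _ ≤ ∫⁻ z, ENNReal.ofReal (Real.exp (φ z + p * Real.log ‖P.eval z‖)) ∂arcsine :=
        ofReal_exp_integral_le_lintegral _ (hi.add (hPi.const_mul p))
    _ = ∫⁻ z, μ.rnDeriv arcsine z * ‖P.eval z‖ₑ ^ p ∂arcsine := by
        refine lintegral_congr_ae ?_
        filter_upwards [h0, hae] with z hz hφ
        have hn : 0 < ‖P.eval z‖ := norm_pos_iff.2 hz
        have e : μ.rnDeriv arcsine z = ENNReal.ofReal (Real.exp (φ z)) := by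
          rw [← EReal.exp_coe, ← hφ, ENNReal.exp_log]
        rw [e, ← ofReal_norm, ENNReal.ofReal_rpow_of_pos hn,
          ← ENNReal.ofReal_mul (Real.exp_pos _).le, Real.exp_add, Real.rpow_def_of_pos hn,
          mul_comm p]
    _ = ∫⁻ z, ‖P.eval z‖ₑ ^ p ∂(arcsine.withDensity (μ.rnDeriv arcsine)) := by
        rw [lintegral_withDensity_eq_lintegral_mul _ (Measure.measurable_rnDeriv _ _) hPm]
        rfl
    -- The singular part of `μ` is discarded here.
    _ ≤ _ := lintegral_mono' (Measure.withDensity_rnDeriv_le _ _) le_rfl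

theorem eLpNorm_rpow_eq_lintegral {p : ℝ} (hp : 0 < p) (μ : Measure ℂ) (f : ℂ → ℂ) :
    eLpNorm f (ENNReal.ofReal p) μ ^ p = ∫⁻ z, ‖f z‖ₑ ^ p ∂μ := by
  rw [eLpNorm_eq_lintegral_rpow_enorm_toReal (by simpa using hp) ENNReal.ofReal_ne_top,
    ENNReal.toReal_ofReal hp.le, ← ENNReal.rpow_mul, one_div, inv_mul_cancel₀ hp.ne',
    ENNReal.rpow_one]

theorem widomFactor_of_support_eq_interval {μ : Measure ℂ} (hsupp : μ.support = interval)
    (p : ℝ≥0∞) (n : ℕ) : widomFactor p n μ =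
      ⨅ P : {P : ℂ[X] // P.Monic ∧ P.natDegree = n}, eLpNorm (fun z => P.1.eval z) p μ := by
  rw [widomFactor, hsupp, capacity_interval, one_pow, div_one]

theorem entropyS_le_widomFactor_rpow {p : ℝ} (hp : 0 < p) (n : ℕ) {μ : Measure ℂ}
    [IsProbabilityMeasure μ] (hsupp : μ.support = interval) (hS : 0 < entropyS μ) :
    entropyS μ ≤ widomFactor (ENNReal.ofReal p) n μ ^ p := by
  rw [widomFactor_of_support_eq_interval hsupp, ← ENNReal.rpow_inv_le_iff hp]
  refine le_iInf fun P => ?_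
  rw [ENNReal.rpow_inv_le_iff hp, eLpNorm_rpow_eq_lintegral hp]
  exact entropyS_le_lintegral hp hsupp hS P.2.1

/-! ### Near-extremal measures. -/

theorem integral_log_norm_sub_add_inv {t : ℝ} (ht : 1 < t) :
    ∫ y, Real.log ‖y - ((t : ℂ) + (t : ℂ)⁻¹)‖ ∂arcsine = Real.log t := by
  have h0 : (0 : ℝ) < t := by linarith
  rw [(integral_log_norm_sub_arcsine (by exact_mod_cast h0.ne')).2, norm_inv, Complex.norm_real,
    Real.norm_of_nonneg h0.le, Real.posLog_eq_log (by rw [abs_of_pos h0]; exact ht.le),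
    Real.posLog_eq_zero_iff _ |>.2, add_zero]
  rw [abs_of_pos (inv_pos.2 h0)]
  exact inv_le_one_of_one_le₀ ht.le

theorem two_lt_add_inv {t : ℝ} (ht : 1 < t) : 2 < t + t⁻¹ := by
  have h0 : (0 : ℝ) < t := by linarith
  have : t + t⁻¹ - 2 = (t - 1) ^ 2 / t := by field_simp; ring
  have : 0 < (t - 1) ^ 2 / t := div_pos (pow_pos (by linarith) 2) h0
  linarith

theorem le_norm_sub_add_inv {t : ℝ} {y : ℂ} (hy : y ∈ interval) :
    t + t⁻¹ - 2 ≤ ‖y - ((t : ℂ) + (t : ℂ)⁻¹)‖ := by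
  obtain ⟨x, hx, rfl⟩ := hy
  rw [← Complex.ofReal_inv, ← Complex.ofReal_add, ← Complex.ofReal_sub, Complex.norm_real,
    Real.norm_eq_abs, abs_sub_comm]
  exact (by linarith [hx.2] : _ ≤ _).trans (le_abs_self _)

/-- The measures with density proportional to `|y - z|^(-np)` for `z = t + 1/t` have a Widom
factor close to the lower bound as `t → 1`. -/
theorem exists_widomFactor_rpow_div_le {p : ℝ} (hp : 0 < p) (n : ℕ) {t : ℝ} (ht : 1 < t) :
    ∃ μ : Measure ℂ, IsProbabilityMeasure μ ∧ μ.support = interval ∧ 0 < entropyS μ ∧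
      widomFactor (ENNReal.ofReal p) n μ ^ p / entropyS μ ≤
        ENNReal.ofReal (Real.exp (n * p * Real.log t)) := by
  set z : ℂ := (t : ℂ) + (t : ℂ)⁻¹ with hz
  set s : ℝ := n * p with hs
  have hs0 : 0 ≤ s := by positivity
  set l : ℂ → ℝ := fun y => Real.log ‖y - z‖ with hl
  have hlm : Measurable l := by fun_prop
  have hae : ∀ᵐ y ∂arcsine, y ∈ interval := arcsine_compl_interval
  have hδ : 0 < t + t⁻¹ - 2 := by linarith [two_lt_add_inv ht]
  have hli : Integrable l arcsine := integrable_log_norm_sub_arcsine z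
  have hlv : ∫ y, l y ∂arcsine = Real.log t := integral_log_norm_sub_add_inv ht
  -- The pole `z` is at positive distance from the interval, so the density is bounded however large
  -- np is.
  have hei : Integrable (fun y => Real.exp (-(s * l y))) arcsine := by
    refine Integrable.of_bound (by fun_prop) (Real.exp (-(s * Real.log (t + t⁻¹ - 2)))) ?_
    filter_upwards [hae] with y hy
    rw [Real.norm_of_nonneg (Real.exp_pos _).le]
    have := Real.log_le_log hδ (le_norm_sub_add_inv (t := t) hy)
    gcongr
  set A := ∫ y, Real.exp (-(s * l y)) ∂arcsine with hA
  have hA0 : 0 < A := integral_exp_pos hei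
  set H : ℂ → ℝ≥0∞ := fun y => ENNReal.ofReal (Real.exp (-(s * l y) - Real.log A)) with hH
  have hHm : Measurable H := by fun_prop
  have hH1 : ∫⁻ y, H y ∂arcsine = 1 := by
    have e (y : ℂ) : Real.exp (-(s * l y) - Real.log A) = Real.exp (-(s * l y)) / A := by
      rw [Real.exp_sub, Real.exp_log hA0]
    simp only [hH, e]
    rw [← ofReal_integral_eq_lintegral_ofReal (hei.div_const A)
      (ae_of_all _ fun y => by positivity), integral_div, ← hA, div_self hA0.ne',
      ENNReal.ofReal_one]
  have hH0 (y : ℂ) : H y ≠ 0 := (ENNReal.ofReal_pos.2 (Real.exp_pos _)).ne'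
  set μ := arcsine.withDensity H with hμ
  have hprob : IsProbabilityMeasure μ := ⟨by simpa [hμ] using hH1⟩
  have hsupp : μ.support = interval := by
    rw [← support_arcsine]
    exact (withDensity_absolutelyContinuous _ _).support_mono.antisymm
      (withDensity_absolutelyContinuous' hHm.aemeasurable (ae_of_all _ hH0)).support_mono
  have hφi : Integrable (fun y => -(s * l y) - Real.log A) arcsine :=
    (hli.const_mul s).neg.sub (integrable_const _)
  have hS : entropyS μ = ENNReal.ofReal (Real.exp (-(s * Real.log t) - Real.log A)) := by
    have hd : (fun y => ENNReal.log (μ.rnDeriv arcsine y)) =ᵐ[arcsine]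
        fun y => ((-(s * l y) - Real.log A : ℝ) : EReal) := by
      filter_upwards [Measure.rnDeriv_withDensity arcsine hHm] with y hy
      rw [hy, hH, ENNReal.log_ofReal_of_pos (Real.exp_pos _), Real.log_exp]
    have hv : ∫ y, (-(s * l y) - Real.log A) ∂arcsine = -(s * Real.log t) - Real.log A := by
      have hi : Integrable (fun y => -(s * l y)) arcsine := (hli.const_mul s).neg
      rw [integral_sub hi (integrable_const _), integral_neg,
        integral_const_mul, hlv]
      simp
    rw [entropyS, hsupp, equilibriumMeasure_interval, extIntegral_congr_ae hd, extIntegral_coe hφi,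
      EReal.exp_coe, hv]
  have hS0 : 0 < entropyS μ := by rw [hS]; exact ENNReal.ofReal_pos.2 (Real.exp_pos _)
  refine ⟨μ, hprob, hsupp, hS0, ENNReal.div_le_of_le_mul ?_⟩
  rw [hS, ← ENNReal.ofReal_mul (Real.exp_pos _).le, ← Real.exp_add]
  have hP : ((X - C z) ^ n : ℂ[X]).Monic ∧ ((X - C z) ^ n : ℂ[X]).natDegree = n :=
    ⟨(monic_X_sub_C z).pow n, by rw [natDegree_pow, natDegree_X_sub_C, mul_one]⟩
  have hle : widomFactor (ENNReal.ofReal p) n μ ≤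
      eLpNorm (fun y => ((X - C z) ^ n : ℂ[X]).eval y) (ENNReal.ofReal p) μ := by
    rw [widomFactor_of_support_eq_interval hsupp]
    exact iInf_le (fun P : {P : ℂ[X] // P.Monic ∧ P.natDegree = n} =>
      eLpNorm (fun y => P.1.eval y) (ENNReal.ofReal p) μ) ⟨_, hP⟩
  have hPm : Measurable fun y => ‖((X - C z) ^ n : ℂ[X]).eval y‖ₑ ^ p :=
    (Polynomial.continuous _).measurable.enorm.pow_const p
  calc _ ≤ _ := ENNReal.rpow_le_rpow hle hp.le
    _ = ∫⁻ y, H y * ‖((X - C z) ^ n : ℂ[X]).eval y‖ₑ ^ p ∂arcsine := by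
        rw [eLpNorm_rpow_eq_lintegral hp, lintegral_withDensity_eq_lintegral_mul _ hHm hPm]
        rfl
    -- The choice s = np makes density times |P|^p constant: the equality case of Jensen.
    _ = ∫⁻ _y, ENNReal.ofReal (Real.exp (-Real.log A)) ∂arcsine := by
        refine lintegral_congr_ae (hae.mono fun y hy => ?_)
        have hn : 0 < ‖y - z‖ := hδ.trans_le (le_norm_sub_add_inv hy)
        simp only [eval_pow, eval_sub, eval_X, eval_C, hH]
        rw [← ofReal_norm, norm_pow, ENNReal.ofReal_rpow_of_pos (by positivity),
          ← ENNReal.ofReal_mul (Real.exp_pos _).le, ← Real.rpow_natCast_mul hn.le,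
          Real.rpow_def_of_pos hn, ← Real.exp_add]
        congr 2
        simp only [hl, hs]
        ring
    _ ≤ _ := by
        rw [lintegral_const, measure_univ, mul_one]
        refine ENNReal.ofReal_le_ofReal (Real.exp_le_exp.2 (le_of_eq ?_))
        ring

end WidomFactors

theorem theorem2p2 (p : ℝ) (hp : 0 < p) (n : ℕ) :
    sInf {r : ℝ≥0∞ | ∃ μ : Measure ℂ, IsProbabilityMeasure μ ∧
        μ.support = WidomFactors.interval ∧
        0 < WidomFactors.entropyS μ ∧
        r = WidomFactors.widomFactor (ENNReal.ofReal p) n μ ^ p / WidomFactors.entropyS μ} = 1 := by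
  refine le_antisymm ?_ (le_sInf ?_)
  · have hc : ContinuousAt (fun t : ℝ => ENNReal.ofReal (Real.exp (n * p * Real.log t))) 1 := by
      have := Real.continuousAt_log one_ne_zero
      exact ENNReal.continuous_ofReal.continuousAt.comp (by fun_prop)
    have ht := hc.tendsto.mono_left (nhdsWithin_le_nhds (s := Set.Ioi 1))
    rw [Real.log_one, mul_zero, Real.exp_zero, ENNReal.ofReal_one] at ht
    refine ge_of_tendsto ht (eventually_nhdsWithin_of_forall fun t ht => ?_)
    obtain ⟨μ, h1, h2, h3, h4⟩ := WidomFactors.exists_widomFactor_rpow_div_le hp n ht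
    exact sInf_le_of_le ⟨μ, h1, h2, h3, rfl⟩ h4
  · rintro r ⟨μ, _, hsupp, hS, rfl⟩
    have hle := WidomFactors.entropyS_le_widomFactor_rpow hp n hsupp hS
    -- The constant polynomial 1 in the entropy bound gives S(μ) ≤ 1.
    have hS' : WidomFactors.entropyS μ ≠ ⊤ := by
      have h := WidomFactors.entropyS_le_lintegral hp hsupp hS Polynomial.monic_one
      refine ne_top_of_le_ne_top ?_ h
      simp
    rwa [ENNReal.le_div_iff_mul_le (Or.inl hS.ne') (Or.inl hS'), one_mul]
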